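/- Let $N\ge 2$ be an integer and let $\Omega_N$ be the hierarchical group of order $N$, i.e. the set of sequences $\mathbf{x}=(x_1,x_2,\ldots)$ with $x_i\in\mathbb{Z}_N$ and $x_i\ne 0$ for only finitely many $i$, with componentwise addition and with the hierarchical distance $d(\mathbf{x},\mathbf{y})=\max\{i: x_i\neq y_i\}$ for $\mathbf{x}\ne\mathbf{y}$, $d(\mathbf{x},\mathbf{x})=0$. Let $0<\alpha\le 1$. Then there is a constant $C^*=C^*(N,\alpha)>0$ such that the following holds for all $C_0,C_1\ge 0$ and all $C_2\ge C^*$. Put $c_k=C_0+C_1\log k+C_2k^\alpha$ for $k\ge 1$ and consider the random graph with vertex set $\Omega_N$ in which, independently for all unordered pairs of distinct points, $\mathbf{x}$ and $\mathbf{y}$ are joined by an edge with probability $$p_{\mathbf{x},\mathbf{y}}=\min\left(\frac{c_k}{N^{2k}},\,1\right)\quad\text{if } d(\mathbf{x},\mathbf{y})=k$$ (the case $\delta=1$ of the connection probabilities $\min(c_k/N^{(1+\delta)k},1)$). Then for almost every realization of this random graph, for every percolation cluster (infinite connected component), each of its vertices has only finitely many neighbours, and the simple random walk on the cluster (which jumps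 at each step to a uniformly chosen neighbour) is recurrent, that is, started at any vertex of the cluster it returns to that vertex with probability $1$. -/

import Mathlib

namespace HierPerc

open MeasureTheory ProbabilityTheory

/-- The hierarchical group of order `N`: sequences in `ℤ/N` with finitely many nonzero terms, added
componentwise. The coordinate `x i`, `i = 0, 1, 2, …`, is the one usually written `x_{i+1}`. -/
abbrev HGroup (N : ℕ) : Type := ℕ →₀ ZMod N

/-- The hierarchical distance: the largest (one-based) index of a coordinate at which `x` and `y`
differ, and `0` if `x = y`. -/
noncomputable def hdist {N : ℕ} (x y : HGroup N) : ℕ :=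
  (x - y).support.sup (fun i => i + 1)

theorem hdist_comm {N : ℕ} (x y : HGroup N) : hdist x y = hdist y x := by
  unfold hdist
  rw [← neg_sub y x, Finsupp.support_neg]

/-- The hierarchical distance between the two end-points of an unordered pair. -/
noncomputable def edgeLength {N : ℕ} : Sym2 (HGroup N) → ℕ :=
  Sym2.lift ⟨hdist, hdist_comm⟩

/-- The coefficients `c_k = C₀ + C₁ log k + C₂ k^α`. -/
noncomputable def coeff (C0 C1 C2 α : ℝ) (k : ℕ) : ℝ :=
  C0 + C1 * Real.log k + C2 * (k : ℝ) ^ α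

/-- The connection probability at distance `k` in the case `δ = 1`: `min (c_k / N^{2k}, 1)`, for
nonnegative `c_k`, as an element of `[0, 1]` (the outer `max` with `0` only serves to make the value
one of `[0, 1]` for all real parameters). -/
noncomputable def connProb (N : ℕ) (c : ℕ → ℝ) (k : ℕ) : unitInterval :=
  ⟨max 0 (min (c k / (N : ℝ) ^ (2 * k)) 1),
    le_max_left _ _, max_le zero_le_one (min_le_right _ _)⟩

/-- The law of the edge configuration: independently for all unordered pairs, the pair `e` is open
(`true`) with probability `connProb N c (edgeLength e)`. The coins of the degenerate pairs `{x, x}`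
are never looked at. -/
noncomputable def percMeasure (N : ℕ) (c : ℕ → ℝ) : Measure (Sym2 (HGroup N) → Bool) :=
  Measure.infinitePi (fun e => bernoulliMeasure true false (connProb N c (edgeLength e)))

/-- The random graph: distinct `x`, `y` are adjacent when the pair `{x, y}` is open. -/
def percGraph {N : ℕ} (η : Sym2 (HGroup N) → Bool) : SimpleGraph (HGroup N) :=
  SimpleGraph.fromEdgeSet {e | η e = true}

section RandomWalk

variable {V : Type*}

open Classical in
/-- One step of simple random walk from `x`: a uniformly chosen neighbour of `x`. (If `x` has no
neighbour or infinitely many, so that there is no such choice, the walk stays at `x`.) -/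
noncomputable def srwStep (G : SimpleGraph V) (x : V) : @Measure V ⊤ :=
  letI : MeasurableSpace V := ⊤
  if (G.neighborSet x).Finite ∧ (G.neighborSet x).Nonempty then uniformOn (G.neighborSet x)
  else Measure.dirac x

theorem srwStep_isProbabilityMeasure (G : SimpleGraph V) (x : V) :
    @IsProbabilityMeasure V ⊤ (srwStep G x) := by
  let _ : MeasurableSpace V := ⊤
  unfold srwStep
  split_ifs with h
  · exact isProbabilityMeasure_uniformOn h.1 h.2
  · infer_instance

/-- The transition kernel of simple random walk at time `n`, as a kernel from the path up to time
`n` to the position at time `n + 1`; it depends on the current position only. -/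
noncomputable def srwKernel (G : SimpleGraph V) (n : ℕ) :
    @Kernel (Finset.Iic n → V) V (@MeasurableSpace.pi _ _ (fun _ => ⊤)) ⊤ :=
  letI : MeasurableSpace V := ⊤
  { toFun := fun ω => srwStep G (ω ⟨n, Finset.mem_Iic.2 le_rfl⟩)
    measurable' :=
      (measurable_from_top (f := srwStep G)).comp
        (measurable_pi_apply (⟨n, Finset.mem_Iic.2 le_rfl⟩ : Finset.Iic n)) }

theorem srwKernel_isMarkovKernel (G : SimpleGraph V) (n : ℕ) :
    @IsMarkovKernel (Finset.Iic n → V) V (@MeasurableSpace.pi _ _ (fun _ => ⊤)) ⊤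
      (srwKernel G n) := by
  let _ : MeasurableSpace V := ⊤
  exact ⟨fun ω => srwStep_isProbabilityMeasure G _⟩

/-- The law, on the space of trajectories `ℕ → V`, of simple random walk on `G` started at `x`. -/
noncomputable def srwLaw (G : SimpleGraph V) (x : V) :
    @Measure (ℕ → V) (@MeasurableSpace.pi _ _ (fun _ => ⊤)) :=
  letI : MeasurableSpace V := ⊤
  haveI : ∀ n, IsMarkovKernel (srwKernel G n) := srwKernel_isMarkovKernel G
  Kernel.traj (X := fun _ => V) (srwKernel G) 0 (fun _ => x)

/-- Simple random walk on the graph `G` is recurrent: from every starting vertex it returns to that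
vertex at some positive time with probability one. -/
def SRWRecurrent (G : SimpleGraph V) : Prop :=
  ∀ x : V, srwLaw G x {ω | ∃ n : ℕ, 1 ≤ n ∧ ω n = x} = 1

end RandomWalk

end HierPerc

/-!
The walk is recurrent on every cluster because almost every realization of the random graph carries
test functions of arbitrarily small Dirichlet energy.

For a locally finite graph, let `g z` be the probability that the walk from `z` never visits `x`
(at times `≥ 0`). The function `2 - g` is positive and superharmonic, and its only charge sits at `x`,
where it is the degree of `x` times the escape probability. Picone's inequality
(`charge_le_energy`) bounds the charge at `x`, times `f x ^ 2 / 2`, by the energy of any finitely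
supported `f`; so the escape probability vanishes once such `f` exist with `f x` bounded below and
energy tending to zero (`srwRecurrent_of_energy`). Energies only decrease on passing to a cluster
(`energy_comp_le`).

The test functions are the logarithmic cut-offs `max 0 (1 - H_k / H_m)`, where `k` is the distance
to the origin and `H` denotes harmonic numbers. Since `α ≤ 1`, the coefficients satisfy `c_k ≤ C k`,
so between the spheres of radii `k < j` there are on average at most `C j N ^ (k - j)` edges, while
the cut-off changes by at most `(j - k) / ((k + 1) H_m)` across each of them. Summing over `j` leaves
a constant times `∑_{k < m} 1 / ((k + 1) H_m ^ 2) = 1 / H_m`, so the expected energy tends to zero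
(`lintegral_energy_cutoff_le`), and by Fatou's lemma the energies have lower limit zero almost surely
(`ae_liminf_energy_cutoff`). Only the marginal edge probabilities enter, through linearity of
expectation. Degrees are finite because their expectations are (`ae_finite_neighborSet`).
-/

namespace HierPerc

open MeasureTheory ProbabilityTheory Filter Topology
open scoped ENNReal

section Walk

variable {V : Type*}

/-! ### The Dirichlet energy and a Picone inequality -/

/-- The Dirichlet energy of `f` on the graph `G`. The sum runs over ordered pairs of adjacent
vertices, so that every edge is counted twice. -/
noncomputable def energy (G : SimpleGraph V) (f : V → ℝ) : ℝ≥0∞ :=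
  ∑' p : V × V, {p : V × V | G.Adj p.1 p.2}.indicator
    (fun p => ENNReal.ofReal ((f p.1 - f p.2) ^ 2)) p

theorem energy_comp_le {W : Type*} (G : SimpleGraph V) (H : SimpleGraph W) (i : H ↪g G)
    (f : V → ℝ) : energy H (f ∘ i) ≤ energy G f := by
  classical
  have hi : Function.Injective (Prod.map i i) := i.injective.prodMap i.injective
  refine le_trans (le_of_eq ?_) (ENNReal.tsum_comp_le_tsum_of_injective hi _)
  refine tsum_congr fun p => ?_
  simp [Set.indicator_apply]

/-- The pointwise inequality behind Picone's identity. -/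
theorem picone (a b s t : ℝ) (hs : 0 < s) (ht : 0 < t) :
    a ^ 2 / s * (s - t) + b ^ 2 / t * (t - s) ≤ (a - b) ^ 2 := by
  have h : (a - b) ^ 2 - (a ^ 2 / s * (s - t) + b ^ 2 / t * (t - s))
      = (a * t - b * s) ^ 2 / (s * t) := by
    field_simp
    ring
  have : 0 ≤ (a * t - b * s) ^ 2 / (s * t) := by positivity
  linarith

/-- If `h` is positive and superharmonic and `f` has finite support, the energy of `f` controls the
charge of `h` at every vertex. -/
theorem charge_le_energy (G : SimpleGraph V) (hfin : ∀ x, (G.neighborSet x).Finite)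
    (f h : V → ℝ) (hf : f.support.Finite) (hpos : ∀ x, 0 < h x)
    (hsuper : ∀ x, 0 ≤ ∑ v ∈ (hfin x).toFinset, (h x - h v)) (x : V) :
    ENNReal.ofReal (f x ^ 2 / h x * ∑ v ∈ (hfin x).toFinset, (h x - h v)) ≤ energy G f := by
  classical
  set T : Finset V := hf.toFinset ∪ hf.toFinset.biUnion (fun u => (hfin u).toFinset) with hT
  let a : V → V → ℝ := fun u v => if G.Adj u v then f u ^ 2 / h u * (h u - h v) else 0
  have hrow : ∀ u, ∑ v ∈ T, a u v = f u ^ 2 / h u * ∑ v ∈ (hfin u).toFinset, (h u - h v) := by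
    intro u
    by_cases hu : f u = 0
    · simp [a, hu]
    · have hsub : (hfin u).toFinset ⊆ T := by
        intro v hv
        refine Finset.mem_union_right _ (Finset.mem_biUnion.2 ⟨u, by simpa using hu, hv⟩)
      rw [Finset.mul_sum, ← Finset.sum_subset hsub]
      · refine Finset.sum_congr rfl fun v hv => ?_
        have : G.Adj u v := by simpa using hv
        simp [a, this]
      · intro v _ hv
        have : ¬ G.Adj u v := by simpa using hv
        simp [a, this]
  have hrow0 : ∀ u, 0 ≤ ∑ v ∈ T, a u v := by
    intro u
    rw [hrow]
    exact mul_nonneg (div_nonneg (sq_nonneg _) (hpos u).le) (hsuper u)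
  have hx : f x ^ 2 / h x * ∑ v ∈ (hfin x).toFinset, (h x - h v) ≤ ∑ u ∈ T, ∑ v ∈ T, a u v := by
    rw [← hrow]
    by_cases hxT : x ∈ T
    · exact Finset.single_le_sum (f := fun u => ∑ v ∈ T, a u v) (fun u _ => hrow0 u) hxT
    · have hfx : f x = 0 := by
        by_contra hne
        exact hxT (Finset.mem_union_left _ (by simpa using hne))
      have : ∑ v ∈ T, a x v = 0 := by simp [a, hfx]
      rw [this]
      exact Finset.sum_nonneg fun u _ => hrow0 u
  have hS0 : 0 ≤ ∑ u ∈ T, ∑ v ∈ T, a u v := Finset.sum_nonneg fun u _ => hrow0 u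
  -- Symmetrize the double sum and apply the pointwise inequality to each edge.
  have hsym : 2 * ∑ u ∈ T, ∑ v ∈ T, a u v
      ≤ ∑ u ∈ T, ∑ v ∈ T, if G.Adj u v then (f u - f v) ^ 2 else 0 := by
    have h1 : 2 * ∑ u ∈ T, ∑ v ∈ T, a u v = ∑ u ∈ T, ∑ v ∈ T, (a u v + a v u) := by
      simp_rw [Finset.sum_add_distrib]
      rw [Finset.sum_comm (f := fun u v => a v u)]
      ring
    rw [h1]
    refine Finset.sum_le_sum fun u _ => Finset.sum_le_sum fun v _ => ?_
    by_cases huv : G.Adj u v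
    · simpa [a, huv, huv.symm] using picone (f u) (f v) (h u) (h v) (hpos u) (hpos v)
    · simp [a, huv, show ¬ G.Adj v u from fun h => huv h.symm]
  have hle : f x ^ 2 / h x * ∑ v ∈ (hfin x).toFinset, (h x - h v)
      ≤ ∑ p ∈ T ×ˢ T, if G.Adj p.1 p.2 then (f p.1 - f p.2) ^ 2 else 0 := by
    rw [Finset.sum_product]
    linarith
  refine (ENNReal.ofReal_le_ofReal hle).trans ?_
  rw [ENNReal.ofReal_sum_of_nonneg (fun p _ => by split_ifs <;> positivity)]
  refine le_trans (le_of_eq ?_) (ENNReal.sum_le_tsum (T ×ˢ T))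
  refine Finset.sum_congr rfl fun p _ => ?_
  by_cases hp : G.Adj p.1 p.2 <;> simp [hp]

/-! ### Return probabilities of simple random walk -/

theorem lintegral_srwStep (G : SimpleGraph V) {x : V} (hfin : (G.neighborSet x).Finite)
    (hne : (G.neighborSet x).Nonempty) (φ : V → ℝ≥0∞) :
    ∫⁻ z, φ z ∂(srwStep G x) = (hfin.toFinset.card : ℝ≥0∞)⁻¹ * ∑ z ∈ hfin.toFinset, φ z := by
  let _ : MeasurableSpace V := ⊤
  have hms : MeasurableSet (G.neighborSet x) := trivial
  rw [srwStep, if_pos ⟨hfin, hne⟩, uniformOn, ProbabilityTheory.cond, lintegral_smul_measure,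
    Measure.count_apply_finite _ hfin, smul_eq_mul]
  congr 1
  rw [← lintegral_indicator hms, lintegral_count' measurable_from_top,
    tsum_eq_sum (s := hfin.toFinset)]
  · exact Finset.sum_congr rfl fun z hz => by simp [show G.Adj x z by simpa using hz]
  · intro z hz
    simp [show ¬ G.Adj x z by simpa using hz]

open Classical in
/-- The probability that simple random walk on `G`, started at the last argument, avoids `x` at all
times `1, …, n`, computed by conditioning on the first step. -/
noncomputable def avoid (G : SimpleGraph V) (x : V) : ℕ → V → ℝ≥0∞
  | 0, _ => 1
  | n + 1, y => @lintegral V ⊤ (srwStep G y) fun z => if z = x then 0 else avoid G x n z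

theorem avoid_le_one (G : SimpleGraph V) (x : V) (n : ℕ) (y : V) : avoid G x n y ≤ 1 := by
  classical
  induction n generalizing y with
  | zero => exact le_rfl
  | succ n ih =>
    let _ : MeasurableSpace V := ⊤
    have := srwStep_isProbabilityMeasure G y
    calc avoid G x (n + 1) y ≤ ∫⁻ _, 1 ∂(srwStep G y) := by
          refine lintegral_mono fun z => ?_
          split_ifs
          · exact zero_le_one
          · exact ih z
      _ = 1 := by simp

theorem avoid_antitone (G : SimpleGraph V) (x y : V) : Antitone fun n => avoid G x n y := by
  classical
  refine antitone_nat_of_succ_le fun n => ?_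
  induction n generalizing y with
  | zero => exact avoid_le_one G x 1 y
  | succ n ih =>
    let _ : MeasurableSpace V := ⊤
    refine lintegral_mono fun z => ?_
    dsimp only
    split_ifs
    · exact le_rfl
    · exact ih z

theorem avoid_one_of_isolated (G : SimpleGraph V) (x : V) (hx : ¬ (G.neighborSet x).Nonempty) :
    avoid G x 1 x = 0 := by
  let _ : MeasurableSpace V := ⊤
  rw [avoid, srwStep, if_neg (fun h => hx h.2)]
  simp

/-- The Markov property at time `n`, tested against products. The law `srwLaw` is built on the discrete
σ-algebra of `V`, so `htop` only makes the measurability of `F` refer to that σ-algebra. -/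
theorem lintegral_srwLaw_mul {m : MeasurableSpace V} (htop : m = ⊤)
    (G : SimpleGraph V) (x : V) (n : ℕ) {F : (Finset.Iic n → V) → ℝ≥0∞} (hF : Measurable F)
    (ψ : V → ℝ≥0∞) :
    ∫⁻ ω, F (Preorder.frestrictLe n ω) * ψ (ω (n + 1)) ∂(srwLaw G x)
      = ∫⁻ ω, F (Preorder.frestrictLe n ω) * (∫⁻ z, ψ z ∂(srwStep G (ω n))) ∂(srwLaw G x) := by
  subst htop
  let _ : MeasurableSpace V := ⊤
  have : ∀ n, IsMarkovKernel (srwKernel G n) := srwKernel_isMarkovKernel G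
  have hψ : Measurable ψ := measurable_from_top
  have hgm : Measurable fun p : (Finset.Iic n → V) × V => F p.1 * ψ p.2 :=
    (hF.comp measurable_fst).mul (hψ.comp measurable_snd)
  have hlaw : srwLaw G x = Kernel.traj (X := fun _ => V) (srwKernel G) 0 (fun _ => x) := rfl
  have hpm : Measurable fun ω : ℕ → V => (Preorder.frestrictLe (π := fun _ => V) n ω, ω (n + 1)) :=
    (Preorder.measurable_frestrictLe n).prodMk (measurable_pi_apply _)
  have h1 : ∫⁻ ω, F (Preorder.frestrictLe n ω) * ψ (ω (n + 1)) ∂(srwLaw G x)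
      = ∫⁻ p, F p.1 * ψ p.2 ∂((srwLaw G x).map
          fun ω => (Preorder.frestrictLe (π := fun _ => V) n ω, ω (n + 1))) :=
    (lintegral_map hgm hpm).symm
  have hκ : Measurable fun ω : Finset.Iic n → V => ∫⁻ z, ψ z ∂(srwKernel G n ω) :=
    hψ.lintegral_kernel
  rw [h1, hlaw, ← Kernel.partialTraj_compProd_eq_map_traj (X := fun _ => V) (Nat.zero_le n),
    Measure.lintegral_compProd hgm, ← Kernel.traj_map_frestrictLe_apply]
  simp_rw [lintegral_const_mul _ hψ]
  exact lintegral_map (hF.mul hκ) (Preorder.measurable_frestrictLe n)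

theorem srwLaw_avoid (G : SimpleGraph V) (x : V) (n : ℕ) :
    srwLaw G x {ω | ∀ i, 1 ≤ i → i ≤ n → ω i ≠ x} = avoid G x n x := by
  classical
  let _ : MeasurableSpace V := ⊤
  have hms : ∀ s : Set V, MeasurableSet s := fun _ => trivial
  have hA : ∀ n, MeasurableSet {ω : ℕ → V | ∀ i, 1 ≤ i → i ≤ n → ω i ≠ x} := by
    intro n
    simp only [Set.ofPred_forall]
    refine MeasurableSet.iInter fun i => MeasurableSet.iInter fun _ => MeasurableSet.iInter fun _ =>
      ?_
    have hi : Measurable fun ω : ℕ → V => ω i := measurable_pi_apply i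
    exact hi (hms {z | z ≠ x})
  have key : ∀ m n, srwLaw G x {ω | ∀ i, 1 ≤ i → i ≤ n + m → ω i ≠ x}
      = ∫⁻ ω, {ω : ℕ → V | ∀ i, 1 ≤ i → i ≤ n → ω i ≠ x}.indicator 1 ω * avoid G x m (ω n)
          ∂(srwLaw G x) := by
    intro m
    induction m with
    | zero =>
      intro n
      simp only [avoid, mul_one, add_zero]
      rw [lintegral_indicator_one (hA n)]
    | succ m ih =>
      intro n
      have hB : MeasurableSet {ω : Finset.Iic n → V | ∀ i : Finset.Iic n, 1 ≤ i.1 → ω i ≠ x} := by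
        simp only [Set.ofPred_forall]
        refine MeasurableSet.iInter fun i => MeasurableSet.iInter fun _ => ?_
        have hi : Measurable fun ω : Finset.Iic n → V => ω i := measurable_pi_apply i
        exact hi (hms {z | z ≠ x})
      have hmk := lintegral_srwLaw_mul rfl G x n
        (F := {ω : Finset.Iic n → V | ∀ i : Finset.Iic n, 1 ≤ i.1 → ω i ≠ x}.indicator 1)
        (measurable_one.indicator hB) (fun z => if z = x then 0 else avoid G x m z)
      have hind : ∀ ω : ℕ → V,
          ({ω : Finset.Iic n → V | ∀ i : Finset.Iic n, 1 ≤ i.1 → ω i ≠ x}.indicator 1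
            (Preorder.frestrictLe (π := fun _ => V) n ω) : ℝ≥0∞)
          = {ω : ℕ → V | ∀ i, 1 ≤ i → i ≤ n → ω i ≠ x}.indicator 1 ω := by
        intro ω
        refine Set.indicator_eq_indicator ?_ rfl
        simp only [Set.mem_ofPred_eq, Preorder.frestrictLe_apply, Subtype.forall, Finset.mem_Iic]
        exact ⟨fun h i h1 h2 => h i h2 h1, fun h i h2 h1 => h i h1 h2⟩
      simp only [hind] at hmk
      rw [show n + (m + 1) = n + 1 + m by ring, ih (n + 1)]
      refine Eq.trans (lintegral_congr fun ω => ?_) hmk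
      have hiff : (∀ i, 1 ≤ i → i ≤ n + 1 → ω i ≠ x)
          ↔ (∀ i, 1 ≤ i → i ≤ n → ω i ≠ x) ∧ ω (n + 1) ≠ x := by
        constructor
        · exact fun h => ⟨fun i h1 h2 => h i h1 (by lia), h _ (by lia) le_rfl⟩
        · rintro ⟨h, h'⟩ i h1 h2
          rcases Nat.lt_or_ge n i with hi | hi
          · obtain rfl : i = n + 1 := by lia
            exact h'
          · exact h i h1 hi
      simp only [Set.indicator_apply, Set.mem_ofPred_eq, hiff, Pi.one_apply]
      by_cases h1 : ∀ i, 1 ≤ i → i ≤ n → ω i ≠ x <;> by_cases h2 : ω (n + 1) = x <;> simp [h1, h2]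
  have h0 := key n 0
  rw [zero_add] at h0
  rw [h0]
  have : ∀ n, IsMarkovKernel (srwKernel G n) := srwKernel_isMarkovKernel G
  have hmeas : Measurable fun ω : ℕ → V =>
      {ω : ℕ → V | ∀ i, 1 ≤ i → i ≤ 0 → ω i ≠ x}.indicator (1 : (ℕ → V) → ℝ≥0∞) ω
        * avoid G x n (ω 0) :=
    (measurable_one.indicator (hA 0)).mul
      ((measurable_from_top (f := avoid G x n)).comp (measurable_pi_apply 0))
  have hset : {ω : ℕ → V | ∀ i, 1 ≤ i → i ≤ 0 → ω i ≠ x} = Set.univ := by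
    ext ω
    simp only [Set.mem_ofPred_eq, Set.mem_univ, iff_true]
    intro i h1 h2
    lia
  have hlaw : srwLaw G x = Kernel.traj (X := fun _ => V) (srwKernel G) 0 (fun _ => x) := rfl
  have := Kernel.lintegral_traj (X := fun _ => V) (κ := srwKernel G) (a := 0) (fun _ => x) hmeas
  rw [hlaw, this]
  simp only [hset, Set.indicator_univ]
  simp [Function.updateFinset]

/-- A locally finite graph is recurrent if every vertex has zero capacity: there are finitely
supported functions, bounded below at the vertex, of arbitrarily small energy. -/
theorem srwRecurrent_of_energy (G : SimpleGraph V) (hfin : ∀ x, (G.neighborSet x).Finite)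
    (h : ∀ x, ∃ c > 0, ∀ ε > (0 : ℝ≥0∞), ∃ f : V → ℝ,
      f.support.Finite ∧ c ≤ f x ∧ energy G f ≤ ε) : SRWRecurrent G := by
  classical
  intro x
  let _ : MeasurableSpace V := ⊤
  have : ∀ n, IsMarkovKernel (srwKernel G n) := srwKernel_isMarkovKernel G
  have : IsProbabilityMeasure (srwLaw G x) := by
    unfold srwLaw
    infer_instance
  let v : V → ℝ≥0∞ := fun y => ⨅ n, avoid G x n y
  have hlim : ∀ y, Tendsto (fun n => avoid G x n y) atTop (𝓝 (v y)) := fun y =>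
    tendsto_atTop_iInf (avoid_antitone G x y)
  have hv1 : ∀ y, v y ≤ 1 := fun y => iInf_le (fun n => avoid G x n y) 0
  have hvtop : ∀ y, v y ≠ ∞ := fun y => ((hv1 y).trans_lt ENNReal.one_lt_top).ne
  -- It suffices that the limiting avoidance probability vanishes.
  suffices hv0 : v x = 0 by
    have hmeas : MeasurableSet {ω : ℕ → V | ∃ n : ℕ, 1 ≤ n ∧ ω n = x} := by
      simp only [Set.ofPred_exists]
      refine MeasurableSet.iUnion fun n => ?_
      exact (MeasurableSet.const (1 ≤ n)).inter
        (measurable_pi_apply (X := fun _ : ℕ => V) n (show MeasurableSet ({x} : Set V) from trivial))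
    rw [← prob_compl_eq_zero_iff hmeas]
    refine le_antisymm ?_ zero_le
    rw [← hv0]
    refine le_iInf fun n => ?_
    rw [← srwLaw_avoid G x n]
    refine measure_mono fun ω hω i h1 _ h3 => hω ⟨i, h1, h3⟩
  by_cases hne : (G.neighborSet x).Nonempty
  swap
  · refine le_antisymm ?_ zero_le
    rw [← avoid_one_of_isolated G x hne]
    exact iInf_le _ 1
  have hharm : ∀ y, (((hfin y).toFinset.card : ℝ≥0∞)) * v y
      = ∑ z ∈ (hfin y).toFinset, if z = x then 0 else v z := by
    intro y
    by_cases hy : (G.neighborSet y).Nonempty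
    · have hcard : ((hfin y).toFinset.card : ℝ≥0∞) ≠ 0 := by
        simpa [Finset.card_eq_zero] using hy.ne_empty
      have h1 : ∀ n, ((hfin y).toFinset.card : ℝ≥0∞) * avoid G x (n + 1) y
          = ∑ z ∈ (hfin y).toFinset, if z = x then 0 else avoid G x n z := by
        intro n
        rw [avoid, lintegral_srwStep G (hfin y) hy, ← mul_assoc,
          ENNReal.mul_inv_cancel hcard (ENNReal.natCast_ne_top _), one_mul]
      have h2 : Tendsto (fun n => ((hfin y).toFinset.card : ℝ≥0∞) * avoid G x (n + 1) y) atTop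
          (𝓝 (((hfin y).toFinset.card : ℝ≥0∞) * v y)) :=
        ENNReal.Tendsto.const_mul ((tendsto_add_atTop_iff_nat 1).2 (hlim y))
          (Or.inr (ENNReal.natCast_ne_top _))
      have h3 : Tendsto (fun n => ∑ z ∈ (hfin y).toFinset, if z = x then 0 else avoid G x n z)
          atTop (𝓝 (∑ z ∈ (hfin y).toFinset, if z = x then 0 else v z)) := by
        refine tendsto_finsetSum _ fun z _ => ?_
        split_ifs
        · exact tendsto_const_nhds
        · exact hlim z
      simp_rw [h1] at h2
      exact tendsto_nhds_unique h2 h3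
    · have : (hfin y).toFinset = ∅ := by
        simpa using Set.not_nonempty_iff_eq_empty.1 hy
      simp [this]
  let g : V → ℝ := fun z => if z = x then 0 else (v z).toReal
  have hg0 : ∀ z, 0 ≤ g z := fun z => by dsimp only [g]; split_ifs <;> positivity
  have hg1 : ∀ z, g z ≤ 1 := fun z => by
    dsimp only [g]
    split_ifs
    · exact zero_le_one
    · exact ENNReal.toReal_le_of_le_ofReal zero_le_one (by simpa using hv1 z)
  have hharm' : ∀ y, ((hfin y).toFinset.card : ℝ) * (v y).toReal
      = ∑ z ∈ (hfin y).toFinset, g z := by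
    intro y
    have := congrArg ENNReal.toReal (hharm y)
    rw [ENNReal.toReal_mul, ENNReal.toReal_natCast, ENNReal.toReal_sum] at this
    · rw [this]
      refine Finset.sum_congr rfl fun z _ => ?_
      dsimp only [g]
      split_ifs <;> simp
    · intro z _
      split_ifs
      · simp
      · exact hvtop z
  -- The constant `2` keeps the superharmonic function `2 - g` away from zero.
  have hch : ∀ y, ∑ z ∈ (hfin y).toFinset, ((2 - g y) - (2 - g z))
      = ((hfin y).toFinset.card : ℝ) * ((v y).toReal - g y) := by
    intro y
    have : ∀ z, (2 - g y) - (2 - g z) = g z - g y := fun z => by ring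
    simp_rw [this]
    rw [Finset.sum_sub_distrib, ← hharm', Finset.sum_const, nsmul_eq_mul]
    ring
  have hcap : ∀ f : V → ℝ, f.support.Finite →
      ENNReal.ofReal (f x ^ 2 / (2 - g x) * (((hfin x).toFinset.card : ℝ) * ((v x).toReal - g x)))
        ≤ energy G f := by
    intro f hf
    have := charge_le_energy G hfin f (fun z => 2 - g z) hf (fun z => by linarith [hg1 z])
      (fun y => by
        rw [hch]
        refine mul_nonneg (Nat.cast_nonneg _) ?_
        dsimp only [g]
        split_ifs
        · simp
        · simp) x
    rwa [hch] at this
  have hgx : g x = 0 := by simp [g]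
  simp only [hgx, sub_zero] at hcap
  by_contra hvx
  have hvpos : 0 < (v x).toReal := ENNReal.toReal_pos hvx (hvtop x)
  have hcard : 0 < ((hfin x).toFinset.card : ℝ) := by
    simpa [Finset.card_pos] using hne
  obtain ⟨c, hc, hc'⟩ := h x
  have hpos : 0 < c ^ 2 / 2 * (((hfin x).toFinset.card : ℝ) * (v x).toReal) := by positivity
  obtain ⟨f, hf, hfx, hfe⟩ := hc' (ENNReal.ofReal
    (c ^ 2 / 2 * (((hfin x).toFinset.card : ℝ) * (v x).toReal)) / 2)
    (ENNReal.div_pos (by simpa using hpos) (by simp))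
  have hle : ENNReal.ofReal (c ^ 2 / 2 * (((hfin x).toFinset.card : ℝ) * (v x).toReal))
      ≤ ENNReal.ofReal (c ^ 2 / 2 * (((hfin x).toFinset.card : ℝ) * (v x).toReal)) / 2 := by
    refine le_trans (ENNReal.ofReal_le_ofReal ?_) ((hcap f hf).trans hfe)
    gcongr
  exact absurd hle (not_le.2 (ENNReal.half_lt_self (by simpa using hpos) ENNReal.ofReal_ne_top))

end Walk

/-! ### The hierarchical distance -/

section Distance

variable {N : ℕ}

theorem hdist_le_iff (x y : HGroup N) (k : ℕ) : hdist x y ≤ k ↔ ∀ i, k ≤ i → x i = y i := by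
  unfold hdist
  rw [Finset.sup_le_iff]
  constructor
  · intro h i hi
    by_contra hne
    have := h i (by simpa [sub_eq_zero] using hne)
    lia
  · intro h i hi
    by_contra hlt
    have := h i (by lia)
    simp [this] at hi

theorem hdist_eq_zero_iff (x y : HGroup N) : hdist x y = 0 ↔ x = y := by
  rw [← Nat.le_zero, hdist_le_iff, Finsupp.ext_iff]
  simp

/-- The ultrametric property for triangles based at the origin. -/
theorem hdist_eq_of_lt {x y : HGroup N} (h : hdist x 0 < hdist y 0) : hdist x y = hdist y 0 := by
  refine le_antisymm ?_ ?_
  · rw [hdist_le_iff]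
    intro i hi
    rw [(hdist_le_iff y 0 _).1 le_rfl i hi, (hdist_le_iff x 0 _).1 h.le i hi]
  · by_contra! hlt
    have hle : hdist y 0 ≤ max (hdist x 0) (hdist x y) := by
      rw [hdist_le_iff]
      intro i hi
      rw [← (hdist_le_iff x y _).1 le_rfl i (le_trans (le_max_right _ _) hi),
        (hdist_le_iff x 0 _).1 le_rfl i (le_trans (le_max_left _ _) hi)]
    rcases le_max_iff.1 hle with h' | h' <;> lia

/-- The ball of radius `k` has at most `N ^ k` points. -/
theorem encard_ball_le [NeZero N] (x : HGroup N) (k : ℕ) :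
    {y : HGroup N | hdist x y ≤ k}.encard ≤ (N : ℕ∞) ^ k := by
  have hinj : Set.InjOn (fun (y : HGroup N) (i : Fin k) => y i) {y | hdist x y ≤ k} := by
    intro y hy z hz hyz
    refine Finsupp.ext fun i => ?_
    rcases Nat.lt_or_ge i k with hi | hi
    · exact congrFun hyz ⟨i, hi⟩
    · rw [← (hdist_le_iff x y k).1 hy i hi, (hdist_le_iff x z k).1 hz i hi]
  rw [← hinj.encard_image]
  refine (Set.encard_le_encard (Set.subset_univ _)).trans ?_
  rw [Set.encard_univ, ENat.card_eq_coe_fintype_card]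
  simp [ZMod.card]

theorem finite_ball [NeZero N] (x : HGroup N) (k : ℕ) : {y : HGroup N | hdist x y ≤ k}.Finite :=
  Set.finite_of_encard_le_coe (k := N ^ k) (by exact_mod_cast encard_ball_le x k)

theorem tsum_hdist_le [NeZero N] (x : HGroup N) (F : ℕ → ℝ≥0∞) :
    ∑' y, F (hdist x y) ≤ ∑' k, (N : ℝ≥0∞) ^ k * F k := by
  rw [← ENNReal.tsum_fiberwise _ (hdist x)]
  refine ENNReal.tsum_le_tsum fun k => ?_
  have h1 : ∑' y : (hdist x) ⁻¹' {k}, F (hdist x y) = ∑' _ : (hdist x) ⁻¹' {k}, F k :=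
    tsum_congr fun y => by rw [show hdist x y = k from y.2]
  rw [h1, ENNReal.tsum_set_const]
  refine mul_le_mul_left ?_ _
  have h2 : ((hdist x) ⁻¹' {k}).encard ≤ (N : ℕ∞) ^ k :=
    (Set.encard_le_encard fun y hy => le_of_eq hy).trans (encard_ball_le x k)
  calc ((((hdist x) ⁻¹' {k}).encard : ℕ∞) : ℝ≥0∞) ≤ (((N : ℕ∞) ^ k : ℕ∞) : ℝ≥0∞) := by
        exact_mod_cast h2
    _ = (N : ℝ≥0∞) ^ k := by push_cast; rfl

end Distance

/-! ### Connection probabilities -/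

section Percolation

variable {N : ℕ}

theorem coeff_le {C0 C1 C2 α : ℝ} (h0 : 0 ≤ C0) (h1 : 0 ≤ C1) (h2 : 0 ≤ C2) (hα1 : α ≤ 1)
    {k : ℕ} (hk : 1 ≤ k) : coeff C0 C1 C2 α k ≤ (C0 + C1 + C2) * k := by
  have hk' : (1 : ℝ) ≤ k := by exact_mod_cast hk
  have hlog : Real.log k ≤ k := (Real.log_le_sub_one_of_pos (by linarith)).trans (by linarith)
  have hpow : (k : ℝ) ^ α ≤ k := by
    simpa using Real.rpow_le_rpow_of_exponent_le hk' hα1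
  unfold coeff
  nlinarith [mul_le_mul_of_nonneg_left hlog h1, mul_le_mul_of_nonneg_left hpow h2,
    mul_le_mul_of_nonneg_left hk' h0]

/-- The bound `C k / N ^ (2 k)` on the probability that two points at distance `k` are adjacent. It
vanishes at `k = 0`, in accordance with the absence of loops. -/
noncomputable def edgeBound (N : ℕ) (C : ℝ) (k : ℕ) : ℝ≥0∞ :=
  ENNReal.ofReal (C * k / (N : ℝ) ^ (2 * k))

theorem percMeasure_adj_le {c : ℕ → ℝ} {C : ℝ} (hC : 0 ≤ C) (hc : ∀ k, 1 ≤ k → c k ≤ C * k)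
    (x y : HGroup N) :
    percMeasure N c {η | (percGraph η).Adj x y} ≤ edgeBound N C (hdist x y) := by
  rcases eq_or_ne x y with rfl | hne
  · simp
  · have hset : {η : Sym2 (HGroup N) → Bool | (percGraph η).Adj x y}
        = (fun η => η s(x, y)) ⁻¹' {true} := by
      ext η
      simp [percGraph, hne]
    have hmp := measurePreserving_eval_infinitePi
      (fun e : Sym2 (HGroup N) => bernoulliMeasure true false (connProb N c (edgeLength e))) s(x, y)
    have hlen : edgeLength s(x, y) = hdist x y := rfl
    have hpos : 1 ≤ hdist x y := Nat.one_le_iff_ne_zero.2 fun h => hne ((hdist_eq_zero_iff x y).1 h)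
    rw [hset, percMeasure]
    refine (hmp.measure_preimage (measurableSet_singleton true).nullMeasurableSet).trans_le ?_
    rw [bernoulliMeasure_apply _ (measurableSet_singleton true), hlen, edgeBound]
    have hreal : (connProb N c (hdist x y) : ℝ) ≤ C * hdist x y / (N : ℝ) ^ (2 * hdist x y) := by
      refine max_le (by positivity) ((min_le_left _ _).trans ?_)
      gcongr
      exact hc _ hpos
    simp only [Set.mem_singleton_iff, if_true, Bool.false_eq_true, if_false]
    rw [ENNReal.ofReal]
    refine ENNReal.coe_le_coe.2 ?_
    rw [← NNReal.coe_le_coe, Real.coe_toNNReal _ (by positivity)]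
    exact hreal

theorem measurableSet_adj (x y : HGroup N) :
    MeasurableSet {η : Sym2 (HGroup N) → Bool | (percGraph η).Adj x y} := by
  have : {η : Sym2 (HGroup N) → Bool | (percGraph η).Adj x y}
      = (fun η => η s(x, y)) ⁻¹' ({b | b = true ∧ x ≠ y}) := by
    ext η
    simp [percGraph]
  rw [this]
  exact measurable_pi_apply s(x, y) (Set.toFinite _).measurableSet

theorem natCast_pow_mul_edgeBound_le (hN : 2 ≤ N) {C : ℝ} (hC : 0 ≤ C) (k d : ℕ) :
    (N : ℝ≥0∞) ^ k * ((N : ℝ≥0∞) ^ (k + d) * edgeBound N C (k + d))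
      ≤ ENNReal.ofReal (C * (k + d) * (1 / 2) ^ d) := by
  have hN' : (2 : ℝ) ≤ N := by exact_mod_cast hN
  have hN0 : (0 : ℝ) < N := by linarith
  rw [edgeBound, ← ENNReal.ofReal_natCast, ← ENNReal.ofReal_pow (by positivity),
    ← ENNReal.ofReal_pow (by positivity), ← ENNReal.ofReal_mul (by positivity),
    ← ENNReal.ofReal_mul (by positivity)]
  refine ENNReal.ofReal_le_ofReal ?_
  have h1 : (N : ℝ) ^ k * ((N : ℝ) ^ (k + d) * (C * ((k + d : ℕ) : ℝ) / (N : ℝ) ^ (2 * (k + d))))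
      = C * (k + d) * (1 / (N : ℝ)) ^ d := by
    rw [show 2 * (k + d) = k + (k + d) + d by ring, pow_add _ (k + (k + d)), pow_add _ k (k + d)]
    push_cast
    rw [one_div, inv_pow]
    field_simp
  rw [h1]
  gcongr

/-! ### Local finiteness -/

theorem ae_finite_neighborSet (hN : 2 ≤ N) {c : ℕ → ℝ} {C : ℝ} (hC : 0 ≤ C)
    (hc : ∀ k, 1 ≤ k → c k ≤ C * k) :
    ∀ᵐ η ∂(percMeasure N c), ∀ x, ((percGraph η).neighborSet x).Finite := by
  have : NeZero N := ⟨by lia⟩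
  rw [ae_all_iff]
  intro x
  let D : (Sym2 (HGroup N) → Bool) → ℝ≥0∞ := fun η =>
    ∑' y, {η | (percGraph η).Adj x y}.indicator 1 η
  have hmeas : ∀ y, Measurable ({η : Sym2 (HGroup N) → Bool | (percGraph η).Adj x y}.indicator
      (1 : (Sym2 (HGroup N) → Bool) → ℝ≥0∞)) := fun y => measurable_one.indicator (measurableSet_adj x y)
  have hDm : Measurable D := Measurable.tsum hmeas
  have hsum : Summable fun d : ℕ => C * d * (1 / 2 : ℝ) ^ d := by
    have := (summable_pow_mul_geometric_of_norm_lt_one (R := ℝ) 1 (r := 1 / 2)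
      (by norm_num)).mul_left C
    simpa [mul_assoc] using this
  have hD : ∫⁻ η, D η ∂(percMeasure N c) ≠ ∞ := by
    refine ne_top_of_le_ne_top hsum.tsum_ofReal_ne_top ?_
    calc ∫⁻ η, D η ∂(percMeasure N c)
        = ∑' y, percMeasure N c {η | (percGraph η).Adj x y} := by
          rw [lintegral_tsum fun y => (hmeas y).aemeasurable]
          exact tsum_congr fun y => lintegral_indicator_one (measurableSet_adj x y)
      _ ≤ ∑' y, edgeBound N C (hdist x y) :=
          ENNReal.tsum_le_tsum fun y => percMeasure_adj_le hC hc x y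
      _ ≤ ∑' k, (N : ℝ≥0∞) ^ k * edgeBound N C k := tsum_hdist_le x _
      _ ≤ ∑' d : ℕ, ENNReal.ofReal (C * d * (1 / 2) ^ d) := by
          refine ENNReal.tsum_le_tsum fun d => ?_
          simpa using natCast_pow_mul_edgeBound_le hN hC 0 d
  filter_upwards [ae_lt_top hDm hD] with η hη
  have h1 : D η = ((percGraph η).neighborSet x).encard := by
    rw [← ENNReal.tsum_set_one, tsum_subtype ((percGraph η).neighborSet x) (fun _ => (1 : ℝ≥0∞))]
    rfl
  rw [h1] at hη
  rw [← Set.encard_lt_top_iff]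
  exact_mod_cast hη

/-! ### Logarithmic cut-offs and their energy -/

/-- The harmonic number `1 + 1/2 + ⋯ + 1/k`, as a real number. -/
noncomputable def harm (k : ℕ) : ℝ := ∑ i ∈ Finset.range k, 1 / ((i : ℝ) + 1)

theorem harm_mono : Monotone harm := by
  refine monotone_nat_of_le_succ fun k => ?_
  rw [harm, harm, Finset.sum_range_succ]
  have : (0 : ℝ) ≤ 1 / ((k : ℝ) + 1) := by positivity
  linarith

theorem tendsto_harm : Tendsto harm atTop atTop := Real.tendsto_sum_range_one_div_nat_succ_atTop

theorem harm_add_sub_le (k d : ℕ) : harm (k + d) - harm k ≤ d / ((k : ℝ) + 1) := by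
  rw [harm, harm, Finset.sum_range_add, add_sub_cancel_left]
  calc ∑ i ∈ Finset.range d, 1 / (((k + i : ℕ) : ℝ) + 1)
      ≤ ∑ _i ∈ Finset.range d, 1 / ((k : ℝ) + 1) := by
        refine Finset.sum_le_sum fun i _ => ?_
        push_cast
        gcongr
        linarith [Nat.cast_nonneg (α := ℝ) i]
    _ = d / ((k : ℝ) + 1) := by simp [div_eq_mul_inv]

/-- The logarithmic cut-off at scale `m`, as a function of the distance to the origin: it decreases
from `1` at the origin to `0` at distance `m`, with increments proportional to `1 / (k + 1)`. -/
noncomputable def cutoff (m k : ℕ) : ℝ := max 0 (1 - harm k / harm m)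

theorem cutoff_eq_zero {m k : ℕ} (hm : 0 < harm m) (h : m ≤ k) : cutoff m k = 0 := by
  refine max_eq_left ?_
  rw [sub_nonpos, one_le_div hm]
  exact harm_mono h

theorem cutoff_sub_sq_le {m : ℕ} (hm : 0 < harm m) (k d : ℕ) :
    (cutoff m k - cutoff m (k + d)) ^ 2 ≤ (d / ((k : ℝ) + 1) / harm m) ^ 2 := by
  rw [sq_le_sq, abs_of_nonneg (a := (d : ℝ) / ((k : ℝ) + 1) / harm m) (by positivity)]
  calc |cutoff m k - cutoff m (k + d)|
      ≤ |(1 - harm k / harm m) - (1 - harm (k + d) / harm m)| := by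
        simpa [cutoff, max_comm] using
          abs_max_sub_max_le_abs (1 - harm k / harm m) (1 - harm (k + d) / harm m) 0
    _ = (harm (k + d) - harm k) / harm m := by
        rw [show (1 - harm k / harm m) - (1 - harm (k + d) / harm m)
          = (harm (k + d) - harm k) / harm m by ring]
        exact abs_of_nonneg (div_nonneg (sub_nonneg.2 (harm_mono (Nat.le_add_right _ _))) hm.le)
    _ ≤ d / ((k : ℝ) + 1) / harm m := by
        gcongr
        exact harm_add_sub_le k d

/-- The contribution to the expected energy of the pairs of points at distances `k < j` from the
origin. -/
noncomputable def shellTerm (N : ℕ) (C : ℝ) (m k j : ℕ) : ℝ≥0∞ :=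
  if k < j then edgeBound N C j * ENNReal.ofReal ((cutoff m k - cutoff m j) ^ 2) else 0

theorem shellTerm_sum_le (hN : 2 ≤ N) {C : ℝ} (hC : 0 ≤ C) {m : ℕ} (hm : 0 < harm m) (k : ℕ) :
    (N : ℝ≥0∞) ^ k * ∑' j, (N : ℝ≥0∞) ^ j * shellTerm N C m k j
      ≤ ENNReal.ofReal (C / harm m ^ 2 * (1 / ((k : ℝ) + 1)))
        * ∑' d : ℕ, ENNReal.ofReal ((d : ℝ) ^ 3 * (1 / 2) ^ d) := by
  have hsplit : ∑' j, (N : ℝ≥0∞) ^ j * shellTerm N C m k j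
      = ∑' d, (N : ℝ≥0∞) ^ (k + d) * shellTerm N C m k (k + d) := by
    rw [← ENNReal.summable.sum_add_tsum_nat_add' (k := k)
      (f := fun j => (N : ℝ≥0∞) ^ j * shellTerm N C m k j), Finset.sum_eq_zero, zero_add]
    · exact tsum_congr fun d => by rw [add_comm d k]
    · intro j hj
      have : ¬ k < j := by simpa using (Finset.mem_range.1 hj).le
      simp [shellTerm, this]
  rw [hsplit, ← ENNReal.tsum_mul_left, ← ENNReal.tsum_mul_left]
  refine ENNReal.tsum_le_tsum fun d => ?_
  rcases Nat.eq_zero_or_pos d with rfl | hd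
  · simp [shellTerm]
  · have hd' : (1 : ℝ) ≤ d := by exact_mod_cast hd
    rw [shellTerm, if_pos (by lia), ← ENNReal.ofReal_mul (by positivity)]
    calc (N : ℝ≥0∞) ^ k * ((N : ℝ≥0∞) ^ (k + d) * (edgeBound N C (k + d)
            * ENNReal.ofReal ((cutoff m k - cutoff m (k + d)) ^ 2)))
        = (N : ℝ≥0∞) ^ k * ((N : ℝ≥0∞) ^ (k + d) * edgeBound N C (k + d))
            * ENNReal.ofReal ((cutoff m k - cutoff m (k + d)) ^ 2) := by ring
      _ ≤ ENNReal.ofReal (C * (k + d) * (1 / 2) ^ d)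
            * ENNReal.ofReal ((d / ((k : ℝ) + 1) / harm m) ^ 2) :=
          mul_le_mul' (natCast_pow_mul_edgeBound_le hN hC k d)
            (ENNReal.ofReal_le_ofReal (cutoff_sub_sq_le hm k d))
      _ ≤ _ := by
          rw [← ENNReal.ofReal_mul (by positivity)]
          refine ENNReal.ofReal_le_ofReal ?_
          have hkd : (k : ℝ) + d ≤ (k + 1) * d := by
            nlinarith [mul_nonneg (Nat.cast_nonneg (α := ℝ) k) (sub_nonneg.2 hd')]
          calc C * (k + d) * (1 / 2) ^ d * (d / ((k : ℝ) + 1) / harm m) ^ 2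
              ≤ C * ((k + 1) * d) * (1 / 2) ^ d * (d / ((k : ℝ) + 1) / harm m) ^ 2 := by gcongr
            _ = C / harm m ^ 2 * (1 / ((k : ℝ) + 1)) * ((d : ℝ) ^ 3 * (1 / 2) ^ d) := by
              field_simp

theorem shellTerm_eq_zero {C : ℝ} {m : ℕ} (hm : 0 < harm m) {k : ℕ} (hk : m ≤ k) (j : ℕ) :
    shellTerm N C m k j = 0 := by
  unfold shellTerm
  split_ifs with h
  · simp [cutoff_eq_zero hm hk, cutoff_eq_zero hm (hk.trans h.le)]
  · rfl

theorem shellTerm_tsum_le (hN : 2 ≤ N) {C : ℝ} (hC : 0 ≤ C) {m : ℕ} (hm : 0 < harm m) :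
    ∑' k, (N : ℝ≥0∞) ^ k * ∑' j, (N : ℝ≥0∞) ^ j * shellTerm N C m k j
      ≤ ENNReal.ofReal (C / harm m) * ∑' d : ℕ, ENNReal.ofReal ((d : ℝ) ^ 3 * (1 / 2) ^ d) := by
  rw [tsum_eq_sum (s := Finset.range m)]
  · refine (Finset.sum_le_sum fun k _ => shellTerm_sum_le hN hC hm k).trans (le_of_eq ?_)
    rw [← Finset.sum_mul, ← ENNReal.ofReal_sum_of_nonneg (fun k _ => by positivity),
      ← Finset.mul_sum]
    congr 2
    change C / harm m ^ 2 * harm m = C / harm m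
    field_simp
  · intro k hk
    simp [shellTerm_eq_zero hm (by simpa using hk : m ≤ k)]

theorem measurable_energy [NeZero N] (f : HGroup N → ℝ) :
    Measurable fun η : Sym2 (HGroup N) → Bool => energy (percGraph η) f := by
  refine Measurable.tsum fun p => ?_
  exact (measurable_const (a := ENNReal.ofReal ((f p.1 - f p.2) ^ 2))).indicator
    (measurableSet_adj p.1 p.2)

theorem lintegral_energy_cutoff_le (hN : 2 ≤ N) {c : ℕ → ℝ} {C : ℝ} (hC : 0 ≤ C)
    (hc : ∀ k, 1 ≤ k → c k ≤ C * k) {m : ℕ} (hm : 0 < harm m) :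
    ∫⁻ η, energy (percGraph η) (fun x => cutoff m (hdist x 0)) ∂(percMeasure N c)
      ≤ 2 * (ENNReal.ofReal (C / harm m)
        * ∑' d : ℕ, ENNReal.ofReal ((d : ℝ) ^ 3 * (1 / 2) ^ d)) := by
  have : NeZero N := ⟨by lia⟩
  set f : HGroup N → ℝ := fun x => cutoff m (hdist x 0) with hf
  let B : HGroup N → HGroup N → ℝ≥0∞ := fun x y => shellTerm N C m (hdist 0 x) (hdist 0 y)
  have hB : ∑' x, ∑' y, B x y
      ≤ ENNReal.ofReal (C / harm m) * ∑' d : ℕ, ENNReal.ofReal ((d : ℝ) ^ 3 * (1 / 2) ^ d) := by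
    refine le_trans ?_ (shellTerm_tsum_le hN hC hm)
    calc ∑' x, ∑' y, B x y
        ≤ ∑' x : HGroup N, ∑' j, (N : ℝ≥0∞) ^ j * shellTerm N C m (hdist 0 x) j :=
          ENNReal.tsum_le_tsum fun x => tsum_hdist_le 0 (shellTerm N C m (hdist 0 x))
      _ ≤ _ := tsum_hdist_le 0 fun k => ∑' j, (N : ℝ≥0∞) ^ j * shellTerm N C m k j
  have hterm : ∀ x y : HGroup N,
      edgeBound N C (hdist x y) * ENNReal.ofReal ((f x - f y) ^ 2) ≤ B x y + B y x := by
    intro x y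
    rcases lt_trichotomy (hdist x 0) (hdist y 0) with h | h | h
    · refine le_trans (le_of_eq ?_) le_self_add
      simp only [B, shellTerm, hdist_comm 0, if_pos h, hf, hdist_eq_of_lt h]
    · simp [hf, h]
    · refine le_trans (le_of_eq ?_) le_add_self
      simp only [B, shellTerm, hdist_comm 0, if_pos h, hf]
      rw [hdist_comm x y, hdist_eq_of_lt h, ← neg_sub, neg_sq]
  calc ∫⁻ η, energy (percGraph η) f ∂(percMeasure N c)
      = ∑' p : HGroup N × HGroup N, ENNReal.ofReal ((f p.1 - f p.2) ^ 2)
          * percMeasure N c {η | (percGraph η).Adj p.1 p.2} := by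
        unfold energy
        rw [lintegral_tsum]
        · refine tsum_congr fun p => ?_
          exact lintegral_indicator_const (measurableSet_adj p.1 p.2) _
        · exact fun p => ((measurable_const (a := ENNReal.ofReal ((f p.1 - f p.2) ^ 2))).indicator
            (measurableSet_adj p.1 p.2)).aemeasurable
    _ ≤ ∑' p : HGroup N × HGroup N, (B p.1 p.2 + B p.2 p.1) := by
        refine ENNReal.tsum_le_tsum fun p => ?_
        rw [mul_comm]
        exact (mul_le_mul_left (percMeasure_adj_le hC hc p.1 p.2) _).trans (hterm p.1 p.2)
    _ = 2 * ∑' x, ∑' y, B x y := by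
        rw [ENNReal.tsum_add, ENNReal.tsum_prod (f := fun x y => B x y),
          ENNReal.tsum_prod (f := fun x y => B y x), ENNReal.tsum_comm (f := fun x y => B y x),
          two_mul]
    _ ≤ _ := by gcongr

theorem ae_liminf_energy_cutoff (hN : 2 ≤ N) {c : ℕ → ℝ} {C : ℝ} (hC : 0 ≤ C)
    (hc : ∀ k, 1 ≤ k → c k ≤ C * k) :
    ∀ᵐ η ∂(percMeasure N c),
      liminf (fun m => energy (percGraph η) (fun x => cutoff m (hdist x 0))) atTop = 0 := by
  have : NeZero N := ⟨by lia⟩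
  have hmeas := fun m => measurable_energy (N := N) (fun x => cutoff m (hdist x 0))
  set D : ℝ≥0∞ := ∑' d : ℕ, ENNReal.ofReal ((d : ℝ) ^ 3 * (1 / 2) ^ d) with hD
  have hDtop : D ≠ ∞ := by
    have := summable_pow_mul_geometric_of_norm_lt_one (R := ℝ) 3 (r := 1 / 2) (by norm_num)
    exact this.tsum_ofReal_ne_top
  have hbound : Tendsto (fun m => 2 * (ENNReal.ofReal (C / harm m) * D)) atTop (𝓝 0) := by
    have h1 : Tendsto (fun m => ENNReal.ofReal (C / harm m)) atTop (𝓝 0) := by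
      simpa using ENNReal.tendsto_ofReal (tendsto_harm.const_div_atTop C)
    have h2 := ENNReal.Tendsto.mul_const (b := D) h1 (Or.inr hDtop)
    simpa using ENNReal.Tendsto.const_mul (a := 2) h2 (Or.inr (by simp))
  have hlim : Tendsto (fun m => ∫⁻ η, energy (percGraph η) (fun x => cutoff m (hdist x 0))
      ∂(percMeasure N c)) atTop (𝓝 0) := by
    refine tendsto_of_tendsto_of_tendsto_of_le_of_le' tendsto_const_nhds hbound
      (Eventually.of_forall fun _ => zero_le) ?_
    filter_upwards [tendsto_harm.eventually_gt_atTop 0] with m hm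
    exact lintegral_energy_cutoff_le hN hC hc hm
  have hint : ∫⁻ η, liminf (fun m => energy (percGraph η) (fun x => cutoff m (hdist x 0))) atTop
      ∂(percMeasure N c) = 0 := by
    refine le_antisymm ((lintegral_liminf_le hmeas).trans ?_) zero_le
    rw [hlim.liminf_eq]
  exact (lintegral_eq_zero_iff (Measurable.liminf hmeas)).1 hint

end Percolation

end HierPerc

theorem theoremT (N : ℕ) (hN : 2 ≤ N) (α : ℝ) (hα : 0 < α) (hα1 : α ≤ 1) :
    ∃ Cstar : ℝ, 0 < Cstar ∧
      ∀ C0 C1 C2 : ℝ, 0 ≤ C0 → 0 ≤ C1 → Cstar ≤ C2 →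
        ∀ᵐ η ∂(HierPerc.percMeasure N (HierPerc.coeff C0 C1 C2 α)),
          ∀ K : (HierPerc.percGraph η).ConnectedComponent, K.supp.Infinite →
            (∀ x : K, (K.toSimpleGraph.neighborSet x).Finite) ∧
              HierPerc.SRWRecurrent K.toSimpleGraph := by
  open HierPerc Filter in
  -- The value `1` only ensures that `C2` is nonnegative; the energy bounds do not see the
  -- percolation threshold.
  refine ⟨1, one_pos, fun C0 C1 C2 h0 h1 h2 => ?_⟩
  have : NeZero N := ⟨by lia⟩
  have hC2 : 0 ≤ C2 := zero_le_one.trans h2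
  have hC : 0 ≤ C0 + C1 + C2 := by positivity
  have hc : ∀ k, 1 ≤ k → coeff C0 C1 C2 α k ≤ (C0 + C1 + C2) * k := fun k hk =>
    coeff_le h0 h1 hC2 hα1 hk
  filter_upwards [ae_finite_neighborSet hN hC hc, ae_liminf_energy_cutoff hN hC hc]
    with η hfin hlim K _
  have hfinK : ∀ x : K, (K.toSimpleGraph.neighborSet x).Finite := fun x =>
    Set.Finite.of_finite_image ((hfin x.1).subset (by rintro _ ⟨y, hy, rfl⟩; exact hy))
      Subtype.val_injective.injOn
  refine ⟨hfinK, srwRecurrent_of_energy _ hfinK fun x => ⟨1 / 2, by norm_num, fun ε hε => ?_⟩⟩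
  have hfreq : ∃ᶠ m in atTop,
      energy (percGraph η) (fun x => cutoff m (hdist x 0)) < ε :=
    frequently_lt_of_liminf_lt (by isBoundedDefault) (by rwa [hlim])
  have hev : ∀ᶠ m in atTop, 0 < harm m ∧ 1 / 2 ≤ cutoff m (hdist x.1 0) := by
    filter_upwards [tendsto_harm.eventually_gt_atTop 0,
      tendsto_harm.eventually_ge_atTop (2 * harm (hdist x.1 0))] with m hm hm2
    refine ⟨hm, le_max_of_le_right ?_⟩
    have : harm (hdist x.1 0) / harm m ≤ 1 / 2 := by
      rw [div_le_iff₀ hm]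
      linarith
    linarith
  obtain ⟨m, hme, hm, hmx⟩ := (hfreq.and_eventually hev).exists
  refine ⟨(fun x => cutoff m (hdist x 0)) ∘ (SimpleGraph.Embedding.induce K.supp), ?_, hmx,
    (energy_comp_le _ _ (SimpleGraph.Embedding.induce K.supp) _).trans hme.le⟩
  refine Set.Finite.of_finite_image ((finite_ball (0 : HGroup N) m).subset ?_)
    Subtype.val_injective.injOn
  rintro _ ⟨y, hy, rfl⟩
  change hdist 0 y.1 ≤ m
  by_contra! hlt
  rw [hdist_comm] at hlt
  exact hy (cutoff_eq_zero hm hlt.le)
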